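/- Let $m>0$, $c\in\mathbb R$, $n\in\mathbb Z$. On the dense open chart $U=(\mathbb R^2\setminus\{O\})\times(S^2\setminus\{N,S\})$ of the Euclidean Schwarzschild manifold $M\cong\mathbb R^2\times S^2$, with coordinates $\tau\in\mathbb R/8\pi m\mathbb Z$, $r>2m$, $\Theta\in(0,\pi)$, $\phi\in\mathbb R/2\pi\mathbb Z$, metric $g=(1-\frac{2m}r)d\tau^2+(1-\frac{2m}r)^{-1}dr^2+r^2(d\Theta^2+\sin^2\Theta\,d\phi^2)$ and orientation $\varepsilon_{\tau r\Theta\phi}=1$, put $X=\frac1{4m}\partial_\tau$, $\xi=g(X,\cdot)$ and $\omega=d\xi+*d\xi$; then $$\omega=-\tfrac12\Big(\tfrac1{r^2}d\tau\wedge dr+\sin\Theta\,d\Theta\wedge d\phi\Big).$$ Identify $SU(2)$ with the unit quaternions and $\mathfrak{su}(2)$ with $\mathrm{Im}\,\mathbb H$ (with $\operatorname{tr}x=2\operatorname{Re}x$). Let $F_A=dA+A\wedge A$ and $\nabla_A s=ds+[A,s]$. Let $$\mathbf q_n=\sin\Theta\cos(n\phi)\,\mathbf i+\sin\Theta\sin(n\phi)\,\mathbf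 j+\cos\Theta\,\mathbf k,$$ $$\widetilde A_n=\tfrac n2\Big(\big(c-\tfrac1r\big)d\tau+\cos\Theta\,d\phi\Big)\mathbf q_n-\tfrac n2d\phi\,\mathbf k+\tfrac12d\Theta\,(\sin(n\phi)\mathbf i-\cos(n\phi)\mathbf j)$$ (the Charap–Duff connection), $$A_n^\pm=\tfrac n2\Big(\big(c-\tfrac1r\big)d\tau+(\mp1+\cos\Theta)d\phi\Big)\mathbf k,\qquad g_n^\pm=\exp\!\big(\pm\mathbf k\tfrac{n\phi}2\big)\exp\!\big(-\mathbf j\tfrac\Theta2\big)\exp\!\big(-\mathbf k\tfrac{n\phi}2\big).$$ Then $\widetilde A_n$ and $A_n^\pm$ are smooth $\mathfrak{su}(2)$-valued one-forms on $U$, $g_n^\pm:U\to SU(2)$ is smooth, $\mathbf q_n$ is a smooth section of unit length of $\mathrm{ad}(P)=U\times\mathrm{Im}\,\mathbb H$, where $P=U\times SU(2)$, and: 1. On $U$, $F_{\widetilde A_n}=n\,\omega\,\mathbf q_n$; hence $*F_{\widetilde A_n}=F_{\widetilde A_n}$. The form $\operatorname{tr}(F_{\widetilde A_n}\wedge F_{\widetilde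 A_n})$ is integrable, and $-\frac1{8\pi^2}\int_M\operatorname{tr}(F_{\widetilde A_n}\wedge F_{\widetilde A_n})=2n^2$, where the integral is over the full-measure chart $U$. 2. For every smooth real function $f$, $\nabla_{\widetilde A_n}(f\mathbf q_n)=df\,\mathbf q_n$ and $\nabla_{\widetilde A_n}\exp(f\mathbf q_n)=df\,\mathbf q_n\exp(f\mathbf q_n)$. Thus $\widetilde A_n$ preserves the $U(1)$-subbundle generated by $\mathbf q_n$, and it is reducible: for every smooth local $SU(2)$-valued section $s$ with $s\mathbf k s^{-1}=\mathbf q_n$, the form $s^{-1}\widetilde A_ns+s^{-1}ds$ takes its values in $\mathbb R\mathbf k$. 3. On $U$, $g_n^\pm\mathbf q_n(g_n^\pm)^{-1}=\mathbf k$, $\;g_n^\pm\widetilde A_n(g_n^\pm)^{-1}+g_n^\pm d(g_n^\pm)^{-1}=A_n^\pm$, and $F_{A_n^\pm}=n\,\omega\,\mathbf k$. There is an $\mathbb H$-valued real-analytic function $G^\pm$ on $\{y\in\mathbb R^3:\pm y_3\ne-|y|\}$ such that $g_n^\pm=G^\pm(r\sin\Theta\cos n\phi,\,r\sin\Theta\sin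 n\phi,\,r\cos\Theta)$ for all $r\ge2m$ and $\Theta\in[0,\pi]$ with $\pm\cos\Theta\neq-1$ (so across $\Theta=0$ for the sign $+$ and across $\Theta=\pi$ for the sign $-$). Moreover $g_n^+=\exp(\mathbf kn\phi)\,g_n^-$ and $A_n^+=A_n^--n\,d\phi\,\mathbf k$. 4. Let $\Phi$ be the Abelian field strength, given by $F_{\widetilde A_n}=\Phi\,\mathbf q_n$, respectively $F_{A_n^\pm}=\Phi\,\mathbf k$. For every $\tau$ and every $r>2m$, with $S^2=\{(\tau,r)\}\times S^2$ oriented by $d\Theta\wedge d\phi$, $$-\frac1{2\pi}\int_{S^2}\Phi=n,\qquad-\frac1{2\pi}\int_{S^2}*\Phi=n,$$ so these instantons are Abelian dyons of magnetic and electric charge $n$. -/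

import Mathlib

namespace CharapDuff

open scoped Quaternion ContDiff

noncomputable section

/-! ### Differential forms in the coordinates `x = (τ, r, Θ, φ)` -/

/-- The coordinate space; `x 0 = τ`, `x 1 = r`, `x 2 = Θ`, `x 3 = φ`. -/
abbrev Coord : Type := Fin 4 → ℝ

/-- The coordinate vector field `∂/∂x^μ`. -/
def e (μ : Fin 4) : Coord := Pi.single μ 1

/-- The coordinate one-form `dx^μ`. -/
def dx (μ : Fin 4) : Coord →L[ℝ] ℝ := ContinuousLinearMap.proj μ

/-- The coordinate range `r > 2m`, `0 < Θ < π` with `τ` and `φ` unrestricted. The chart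
`U = (ℝ² ∖ {O}) × (S² ∖ {N, S})` of the Euclidean Schwarzschild manifold is the quotient of this set
by `τ ↦ τ + 8πm` and `φ ↦ φ + 2π`. -/
def chart (m : ℝ) : Set Coord := {x | 2 * m < x 1 ∧ 0 < x 2 ∧ x 2 < Real.pi}

/-- A fundamental domain of `chart m` for the two periods; it covers the Euclidean Schwarzschild
manifold up to a null set. -/
def fundamentalDomain (m : ℝ) : Set Coord :=
  {x | x 0 ∈ Set.Ioo 0 (8 * Real.pi * m) ∧ 2 * m < x 1 ∧ x 2 ∈ Set.Ioo 0 Real.pi ∧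
    x 3 ∈ Set.Ioo 0 (2 * Real.pi)}

/-- A function (or the coefficient map of a form) descends to `U`: it is invariant under
`τ ↦ τ + 8πm` and `φ ↦ φ + 2π`. -/
def Descends {α : Type*} (m : ℝ) (f : Coord → α) : Prop :=
  ∀ x, f (x + (8 * Real.pi * m) • e 0) = f x ∧ f (x + (2 * Real.pi) • e 3) = f x

/-- Two-forms (at a point) with values in `W`. -/
abbrev TwoForm (W : Type*) [NormedAddCommGroup W] [NormedSpace ℝ W] : Type _ :=
  Coord [⋀^Fin 2]→L[ℝ] W

/-- The wedge product of two (algebra-valued) one-forms. -/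
def wedge {W : Type*} [NormedRing W] [NormedAlgebra ℝ W] (α β : Coord →L[ℝ] W) : TwoForm W :=
  ContinuousMultilinearMap.alternatization
    ((ContinuousMultilinearMap.mkPiAlgebraFin ℝ 2 W).compContinuousLinearMap ![α, β])

theorem wedge_apply {W : Type*} [NormedRing W] [NormedAlgebra ℝ W] (α β : Coord →L[ℝ] W)
    (v : Fin 2 → Coord) : wedge α β v = α (v 0) * β (v 1) - α (v 1) * β (v 0) := by
  have h : (Finset.univ : Finset (Equiv.Perm (Fin 2))) = {1, Equiv.swap 0 1} := by decide
  rw [wedge, ContinuousMultilinearMap.alternatization_apply_apply, h,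
    Finset.sum_pair (by decide)]
  simp [ContinuousMultilinearMap.mkPiAlgebraFin_apply, sub_eq_add_neg]

/-- The exterior derivative of a one-form. -/
def dOne {W : Type*} [NormedAddCommGroup W] [NormedSpace ℝ W] (A : Coord → Coord →L[ℝ] W)
    (x : Coord) : TwoForm W :=
  extDeriv (fun y => ContinuousAlternatingMap.ofSubsingleton ℝ Coord W (0 : Fin 1) (A y)) x

/-- The components `F^{αβ} = g^{αρ} g^{βσ} F_{ρσ}` of a two-form with both indices raised. -/
def raised {W : Type*} [NormedAddCommGroup W] [NormedSpace ℝ W] (g : Matrix (Fin 4) (Fin 4) ℝ)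
    (F : TwoForm W) (a b : Fin 4) : W :=
  ∑ p, ∑ q, (g⁻¹ a p * g⁻¹ b q) • F ![e p, e q]

/-- The Hodge operator on two-forms for the metric with matrix `g` and the orientation with
`ε_{τ r Θ φ} = 1`:
`*F = 1/4 √(det g) ε_{α β μ ν} F^{α β} dx^μ ∧ dx^ν`, a sum over permutations `(α, β, μ, ν)`. -/
def hodge {W : Type*} [NormedAddCommGroup W] [NormedSpace ℝ W] (g : Matrix (Fin 4) (Fin 4) ℝ)
    (F : TwoForm W) : TwoForm W :=
  (Real.sqrt g.det / 4) • ∑ σ : Equiv.Perm (Fin 4), (((Equiv.Perm.sign σ : ℤˣ) : ℤ) : ℝ) •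
    (wedge (dx (σ 2)) (dx (σ 3))).smulRight (raised g F (σ 0) (σ 1))

/-- The coefficient of `dτ ∧ dr ∧ dΘ ∧ dφ` in the four-form `F ∧ G`. -/
def wedgeCoeff {W : Type*} [NormedRing W] [NormedAlgebra ℝ W] (F G : TwoForm W) : W :=
  (1 / 4 : ℝ) • ∑ σ : Equiv.Perm (Fin 4), (((Equiv.Perm.sign σ : ℤˣ) : ℤ) : ℝ) •
    (F ![e (σ 0), e (σ 1)] * G ![e (σ 2), e (σ 3)])

/-! ### The Euclidean Schwarzschild metric and its self-dual harmonic form -/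

/-- `ds² = (1 - 2m/r) dτ² + (1 - 2m/r)⁻¹ dr² + r² (dΘ² + sin² Θ dφ²)`. -/
def metric (m : ℝ) (x : Coord) : Matrix (Fin 4) (Fin 4) ℝ :=
  Matrix.diagonal ![1 - 2 * m / x 1, (1 - 2 * m / x 1)⁻¹, x 1 ^ 2, x 1 ^ 2 * Real.sin (x 2) ^ 2]

/-- The Killing field `X = (1/4m) ∂/∂τ`. -/
def killing (m : ℝ) : Coord := (1 / (4 * m)) • e 0

/-- The one-form `ξ = g(X, ·)`. -/
def xi (m : ℝ) (x : Coord) : Coord →L[ℝ] ℝ :=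
  ∑ ν, (∑ μ, killing m μ * metric m x μ ν) • dx ν

/-- The self-dual two-form `ω = dξ + *dξ`. -/
def omega (m : ℝ) (x : Coord) : TwoForm ℝ :=
  dOne (xi m) x + hodge (metric m x) (dOne (xi m) x)

/-! ### `SU(2)` gauge theory: `SU(2)` is the group of unit quaternions, `su(2) = Im ℍ` -/

/-- The quaternion units. -/
def qi : ℍ[ℝ] := ⟨0, 1, 0, 0⟩
/-- The quaternion units. -/
def qj : ℍ[ℝ] := ⟨0, 0, 1, 0⟩
/-- The quaternion units. -/
def qk : ℍ[ℝ] := ⟨0, 0, 0, 1⟩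

/-- A smooth connection form of the trivial `SU(2)`-bundle over `U`. -/
structure IsSU2Connection (m : ℝ) (A : Coord → Coord →L[ℝ] ℍ[ℝ]) : Prop where
  smooth : ContDiffOn ℝ ∞ A (chart m)
  imaginary : ∀ x v, (A x v).re = 0
  descends : Descends m A

/-- A smooth gauge transformation `U → SU(2)`. -/
structure IsGaugeTransformation (m : ℝ) (g : Coord → ℍ[ℝ]) : Prop where
  smooth : ContDiffOn ℝ ∞ g (chart m)
  unit : ∀ x, ‖g x‖ = 1
  descends : Descends m g

/-- A smooth section over `U`, of unit length, of the bundle `ad P = U × Im ℍ`. -/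
structure IsUnitAdSection (m : ℝ) (u : Coord → ℍ[ℝ]) : Prop where
  smooth : ContDiffOn ℝ ∞ u (chart m)
  imaginary : ∀ x, (u x).re = 0
  unit : ∀ x, ‖u x‖ = 1
  descends : Descends m u

/-- The curvature `F_A = dA + A ∧ A`. -/
def curvature (A : Coord → Coord →L[ℝ] ℍ[ℝ]) (x : Coord) : TwoForm ℍ[ℝ] :=
  dOne A x + wedge (A x) (A x)

/-- The covariant derivative `ds + [A, s]`, for sections `s` of the bundle associated with the
conjugation action on `ℍ` (so of `ad P` and of `Ad P` in particular). -/
def covDeriv (A : Coord → Coord →L[ℝ] ℍ[ℝ]) (s : Coord → ℍ[ℝ]) (x v : Coord) : ℍ[ℝ] :=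
  fderiv ℝ s x v + (A x v * s x - s x * A x v)

/-- The gauge transformed connection form `g A g⁻¹ + g d(g⁻¹)`. -/
def gaugeTransform (g : Coord → ℍ[ℝ]) (A : Coord → Coord →L[ℝ] ℍ[ℝ]) (x : Coord) :
    Coord →L[ℝ] ℍ[ℝ] :=
  (ContinuousLinearMap.mulLeftRight ℝ ℍ[ℝ] (g x) (g x)⁻¹).comp (A x) +
    (ContinuousLinearMap.mul ℝ ℍ[ℝ] (g x)).comp (fderiv ℝ (fun y => (g y)⁻¹) x)

/-- A unit section `u` of `ad P` determines the principal `U(1)`-subbundle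
`Q_u = {(x, p) | p k p⁻¹ = u x}` of `P = U × SU(2)`, where `U(1) = exp(ℝ k)`. The connection `A`
reduces to `Q_u` when for every local section `s` of `Q_u` the connection form in the gauge `s`,
which is `s⁻¹ A s + s⁻¹ ds`, takes its values in `u(1) = ℝ k`. -/
def ReducesTo (m : ℝ) (A : Coord → Coord →L[ℝ] ℍ[ℝ]) (u : Coord → ℍ[ℝ]) : Prop :=
  ∀ O : Set Coord, IsOpen O → O ⊆ chart m → ∀ s : Coord → ℍ[ℝ], ContDiffOn ℝ ∞ s O →
    (∀ x ∈ O, ‖s x‖ = 1 ∧ s x * qk * (s x)⁻¹ = u x) →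
      ∀ x ∈ O, ∀ v, ∃ t : ℝ, gaugeTransform (fun y => (s y)⁻¹) A x v = t • qk

/-- The trace of the `2 × 2` complex matrix that represents the quaternion `q`. -/
def su2Trace (q : ℍ[ℝ]) : ℝ := 2 * q.re

/-- The density (coefficient of `dτ ∧ dr ∧ dΘ ∧ dφ`) of `-(1/8π²) tr(F_A ∧ F_A)`. -/
def pontryaginDensity (A : Coord → Coord →L[ℝ] ℍ[ℝ]) (x : Coord) : ℝ :=
  -(1 / (8 * Real.pi ^ 2)) * su2Trace (wedgeCoeff (curvature A x) (curvature A x))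

/-- The Abelian field strength `⟨u, F⟩`; if `F = Φ u` with `u` a unit section, it is `Φ`. -/
def fieldStrength (u : Coord → ℍ[ℝ]) (F : Coord → TwoForm ℍ[ℝ]) (x : Coord) : TwoForm ℝ :=
  (innerSL ℝ (u x)).compContinuousAlternatingMap (F x)

/-- `-(1/2π) ∫ Φ` over the two-sphere `{(τ, r)} × S²`, oriented by `dΘ ∧ dφ`. -/
def charge (Φ : Coord → TwoForm ℝ) (τ r : ℝ) : ℝ :=
  -(1 / (2 * Real.pi)) * ∫ φ in (0 : ℝ)..(2 * Real.pi), ∫ Θ in (0 : ℝ)..Real.pi,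
    Φ ![τ, r, Θ, φ] ![e 2, e 3]

/-- The magnetic charge `-(1/2π) ∫_{S²} Φ`. -/
def magneticCharge (Φ : Coord → TwoForm ℝ) (τ r : ℝ) : ℝ := charge Φ τ r

/-- The electric charge `-(1/2π) ∫_{S²} *Φ`. -/
def electricCharge (m : ℝ) (Φ : Coord → TwoForm ℝ) (τ r : ℝ) : ℝ :=
  charge (fun x => hodge (metric m x) (Φ x)) τ r

/-! ### The connections and the gauge transformations -/

/-- `q_n = sin Θ cos(nφ) i + sin Θ sin(nφ) j + cos Θ k`. -/
def q (n : ℤ) (x : Coord) : ℍ[ℝ] :=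
  (Real.sin (x 2) * Real.cos (n * x 3)) • qi + (Real.sin (x 2) * Real.sin (n * x 3)) • qj +
    Real.cos (x 2) • qk

/-- The Charap–Duff connection
`n/2 ((c - 1/r) dτ + cos Θ dφ) q_n - n/2 dφ k + 1/2 dΘ (sin(nφ) i - cos(nφ) j)`. -/
def charapDuff (n : ℤ) (c : ℝ) (x : Coord) : Coord →L[ℝ] ℍ[ℝ] :=
  (((n : ℝ) / 2) • ((c - 1 / x 1) • dx 0 + Real.cos (x 2) • dx 3)).smulRight (q n x)
    - (((n : ℝ) / 2) • dx 3).smulRight qk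
    + ((1 / 2 : ℝ) • dx 2).smulRight (Real.sin (n * x 3) • qi - Real.cos (n * x 3) • qj)

/-- The Abelian connections `A_n^±`, with `ε` the sign:
`n/2 ((c - 1/r) dτ + (∓1 + cos Θ) dφ) k`. -/
def abelian (n : ℤ) (c : ℝ) (ε : ℤˣ) (x : Coord) : Coord →L[ℝ] ℍ[ℝ] :=
  (((n : ℝ) / 2) • ((c - 1 / x 1) • dx 0 +
    (-((ε : ℤ) : ℝ) + Real.cos (x 2)) • dx 3)).smulRight qk

/-- The gauge transformations `g_n^± = exp(± k nφ/2) exp(-j Θ/2) exp(-k nφ/2)`, with `ε` the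
sign. -/
def gauge (n : ℤ) (ε : ℤˣ) (x : Coord) : ℍ[ℝ] :=
  NormedSpace.exp ((((ε : ℤ) : ℝ) * (n * x 3 / 2)) • qk) *
    NormedSpace.exp ((-(x 2 / 2)) • qj) * NormedSpace.exp ((-(n * x 3 / 2)) • qk)

/-- The Cartesian coordinates `(r sin Θ cos(nφ), r sin Θ sin(nφ), r cos Θ)`. -/
def cartesian (n : ℤ) (x : Coord) : EuclideanSpace ℝ (Fin 3) :=
  !₂[x 1 * Real.sin (x 2) * Real.cos (n * x 3), x 1 * Real.sin (x 2) * Real.sin (n * x 3),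
    x 1 * Real.cos (x 2)]

end

end CharapDuff

open CharapDuff
open scoped Quaternion ContDiff

namespace CharapDuff

/-! The metric is diagonal with volume density `r² sin Θ`, so the Hodge operator exchanges `dτ ∧ dr`
and `dΘ ∧ dφ` up to that factor (`hodge_smulRight`). This identifies `ω` and makes every multiple of
it self-dual. The Abelian potential has exterior derivative `n ω` and commutes with itself, which
gives its curvature. For the Charap–Duff connection the curvature is a direct computation,
polynomial in the trigonometric functions modulo `sin² + cos² = 1` (`curvature_charapDuff`).

Reducibility rests on `∇ q_n = 0` (`fderiv_q_add_bracket`): covariant derivatives of functions of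
`q_n` follow from the Leibniz rule, and in a frame adapted to `q_n` the connection form commutes
with `k`.

Since `q_n² = -1`, the Pontryagin density is a multiple of `ω ∧ ω`, which is a product of functions
of one coordinate, so the integral splits. The magnetic charge is the integral of `sin Θ`, and
self-duality equates the electric charge with it.

The gauge transformations are expanded into explicit quaternions in which `φ` occurs only through
`nφ`; periodicity, the gauge law and the extension across one pole are read off from these forms. -/

/-! ### Exterior derivative and Hodge operator in coordinates. -/

theorem sum_sign_smul_perm_fin_four {V : Type*} [AddCommGroup V] [Module ℝ V]
    (T : Fin 4 → Fin 4 → Fin 4 → Fin 4 → V) :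
    ∑ σ : Equiv.Perm (Fin 4), (((Equiv.Perm.sign σ : ℤˣ) : ℤ) : ℝ) • T (σ 0) (σ 1) (σ 2) (σ 3) =
      T 0 1 2 3 - T 0 1 3 2 - T 0 2 1 3 + T 0 2 3 1 + T 0 3 1 2 - T 0 3 2 1
      - T 1 0 2 3 + T 1 0 3 2 + T 1 2 0 3 - T 1 2 3 0 - T 1 3 0 2 + T 1 3 2 0
      + T 2 0 1 3 - T 2 0 3 1 - T 2 1 0 3 + T 2 1 3 0 + T 2 3 0 1 - T 2 3 1 0
      - T 3 0 1 2 + T 3 0 2 1 + T 3 1 0 2 - T 3 1 2 0 - T 3 2 0 1 + T 3 2 1 0 := by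
  -- Indices in successor form let the recursive description `Equiv.Perm.decomposeFin` evaluate each
  -- permutation.
  have h1 : (1 : Fin 4) = Fin.succ 0 := rfl
  have h2 : (2 : Fin 4) = Fin.succ (Fin.succ 0) := rfl
  have h3 : (3 : Fin 4) = Fin.succ (Fin.succ (Fin.succ 0)) := rfl
  rw [h1, h2, h3]
  simp only [Finset.univ_perm_fin_succ, Finset.sum_map, Finset.univ_product_univ.symm,
    Finset.sum_product, Fin.sum_univ_succ, Equiv.toEmbedding_apply, Equiv.Perm.decomposeFin.symm_sign,
    Equiv.Perm.decomposeFin_symm_apply_zero, Equiv.Perm.decomposeFin_symm_apply_succ]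
  simp [Equiv.swap_apply_def]
  abel

/-- Here `A' w` is the derivative of the component `A(w)` for a constant vector `w`, so curvatures
need only derivatives of components. -/
theorem dOne_apply {W : Type*} [NormedAddCommGroup W] [NormedSpace ℝ W]
    {A : Coord → Coord →L[ℝ] W} {A' : Coord → Coord →L[ℝ] W} {x : Coord}
    (hA : DifferentiableAt ℝ A x) (h : ∀ w, HasFDerivAt (fun y => A y w) (A' w) x)
    (v : Fin 2 → Coord) :
    dOne A x v = A' (v 1) (v 0) - A' (v 0) (v 1) := by
  have hd : DifferentiableAt ℝ
      (fun y => ContinuousAlternatingMap.ofSubsingleton ℝ Coord W (0 : Fin 1) (A y)) x :=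
    (ContinuousAlternatingMap.ofSubsingletonLIE (𝕜 := ℝ) (E := Coord) (F := W)
      (0 : Fin 1)).toContinuousLinearEquiv.differentiableAt.comp x hA
  rw [dOne, extDeriv_apply hd, Fin.sum_univ_two]
  simp only [ContinuousAlternatingMap.ofSubsingleton_apply_apply, (h _).fderiv]
  simp [Fin.removeNth_apply, sub_eq_add_neg]

theorem isOpen_chart (m : ℝ) : IsOpen (chart m) := by
  have h (i : Fin 4) : Continuous fun x : Coord => x i := continuous_apply i
  exact (isOpen_lt continuous_const (h 1)).inter
    ((isOpen_lt continuous_const (h 2)).inter (isOpen_lt (h 2) continuous_const))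

/-- The factors `1 - 2m/r` and its inverse cancel both in the determinant and in raising the pair `τ
r`, leaving only `r² sin Θ`. A general coefficient `w` serves real forms (`w = 1`) and quaternionic
ones alike. -/
theorem hodge_smulRight {W : Type*} [NormedAddCommGroup W] [NormedSpace ℝ W] {m : ℝ} (hm : 0 < m)
    {x : Coord} (hx : x ∈ chart m) (a b : ℝ) (w : W) :
    hodge (metric m x) ((a • wedge (dx 0) (dx 1) + b • wedge (dx 2) (dx 3)).smulRight w) =
      ((b / (x 1 ^ 2 * Real.sin (x 2))) • wedge (dx 0) (dx 1) +
        (a * (x 1 ^ 2 * Real.sin (x 2))) • wedge (dx 2) (dx 3)).smulRight w := by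
  obtain ⟨h1, h2, h3⟩ := hx
  have hr : 0 < x 1 := by linarith
  have hs : 0 < Real.sin (x 2) := Real.sin_pos_of_pos_of_lt_pi h2 h3
  have hne : x 1 - 2 * m ≠ 0 := (sub_pos.2 h1).ne'
  have hf : 0 < 1 - 2 * m / x 1 := by rw [sub_pos, div_lt_one hr]; exact h1
  have hdet : Real.sqrt (metric m x).det = x 1 ^ 2 * Real.sin (x 2) := by
    rw [metric, Matrix.det_diagonal, Fin.prod_univ_four,
      ← Real.sqrt_sq (by positivity : 0 ≤ x 1 ^ 2 * Real.sin (x 2))]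
    congr 1
    simp
    field_simp
  have hinv : (metric m x)⁻¹ = Matrix.diagonal ![(1 - 2 * m / x 1)⁻¹, 1 - 2 * m / x 1,
      (x 1 ^ 2)⁻¹, (x 1 ^ 2 * Real.sin (x 2) ^ 2)⁻¹] := by
    refine Matrix.inv_eq_left_inv ?_
    rw [metric, Matrix.diagonal_mul_diagonal, ← Matrix.diagonal_one]
    congr 1
    ext i
    fin_cases i <;> simp <;> field_simp
  have hraised : ∀ (F : TwoForm W) (i j : Fin 4), raised (metric m x) F i j =
      ((metric m x)⁻¹ i i * (metric m x)⁻¹ j j) • F ![e i, e j] := by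
    intro F i j
    rw [raised, Finset.sum_eq_single i, Finset.sum_eq_single j]
    all_goals simp +contextual [hinv, Matrix.diagonal_apply, eq_comm]
  ext v
  simp only [hodge, hdet, ContinuousAlternatingMap.smul_apply, ContinuousAlternatingMap.sum_apply,
    ContinuousAlternatingMap.smulRight_apply, hraised]
  refine (congrArg _ (sum_sign_smul_perm_fin_four fun i j k l => wedge (dx k) (dx l) v •
    ((metric m x)⁻¹ i i * (metric m x)⁻¹ j j) •
      (a • wedge (dx 0) (dx 1) + b • wedge (dx 2) (dx 3)) ![e i, e j] • w)).trans ?_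
  simp only [hinv, ContinuousAlternatingMap.add_apply, ContinuousAlternatingMap.smul_apply,
    wedge_apply, dx, e]
  simp
  match_scalars
  field_simp
  ring

/-! ### The self-dual harmonic form. -/

/-- The explicit form of `ω`: `-1/2 (r⁻² dτ ∧ dr + sin Θ dΘ ∧ dφ)`. -/
noncomputable def omegaForm (x : Coord) : TwoForm ℝ :=
  (-(1 / 2) : ℝ) •
    ((1 / x 1 ^ 2) • wedge (dx 0) (dx 1) + Real.sin (x 2) • wedge (dx 2) (dx 3))

theorem omegaForm_apply (x : Coord) (v : Fin 2 → Coord) :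
    omegaForm x v = -(1 / 2) * (1 / x 1 ^ 2 * (v 0 0 * v 1 1 - v 1 0 * v 0 1) +
      Real.sin (x 2) * (v 0 2 * v 1 3 - v 1 2 * v 0 3)) := by
  simp only [omegaForm, ContinuousAlternatingMap.smul_apply, ContinuousAlternatingMap.add_apply,
    wedge_apply, dx, ContinuousLinearMap.proj_apply, smul_eq_mul]

theorem hodge_omegaForm_smulRight {W : Type*} [NormedAddCommGroup W] [NormedSpace ℝ W] {m : ℝ}
    (hm : 0 < m) {x : Coord} (hx : x ∈ chart m) (t : ℝ) (w : W) :
    hodge (metric m x) ((t • omegaForm x).smulRight w) = (t • omegaForm x).smulRight w := by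
  have hr : 0 < x 1 := by linarith [hx.1]
  have hs : 0 < Real.sin (x 2) := Real.sin_pos_of_pos_of_lt_pi hx.2.1 hx.2.2
  have h := hodge_smulRight hm hx (t * (-(1 / 2) * (1 / x 1 ^ 2))) (t * (-(1 / 2) * Real.sin (x 2))) w
  simp only [mul_smul, ← smul_add] at h
  rw [omegaForm, h]
  congr 2
  match_scalars <;> field_simp

theorem smulRight_one_eq (F : TwoForm ℝ) : F.smulRight (1 : ℝ) = F := by
  ext v
  simp

theorem hodge_omegaForm {m : ℝ} (hm : 0 < m) {x : Coord} (hx : x ∈ chart m) (t : ℝ) :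
    hodge (metric m x) (t • omegaForm x) = t • omegaForm x := by
  simpa only [smulRight_one_eq] using hodge_omegaForm_smulRight hm hx t (1 : ℝ)

theorem hasFDerivAt_coord (i : Fin 4) (x : Coord) : HasFDerivAt (fun y : Coord => y i) (dx i) x :=
  (dx i).hasFDerivAt

theorem hasFDerivAt_comp_coord {f : ℝ → ℝ} {f' : ℝ} {i : Fin 4} {x : Coord}
    (h : HasDerivAt f f' (x i)) : HasFDerivAt (fun y : Coord => f (y i)) (f' • dx i) x :=
  h.comp_hasFDerivAt x (hasFDerivAt_coord i x)

theorem xi_eq {m : ℝ} (x : Coord) :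
    xi m x = (1 / (4 * m) * (1 - 2 * m / x 1)) • dx 0 := by
  simp [xi, killing, metric, e, Fin.sum_univ_four, Matrix.diagonal_apply]

theorem dOne_xi {m : ℝ} (hm : 0 < m) {x : Coord} (hx : x ∈ chart m) :
    dOne (xi m) x = (-(1 / 2) * (1 / x 1 ^ 2)) • wedge (dx 0) (dx 1) := by
  have hr : x 1 ≠ 0 := by linarith [hx.1]
  have hf : HasFDerivAt (fun y : Coord => 1 / (4 * m) * (1 - 2 * m / y 1))
      ((1 / 2 * (1 / x 1 ^ 2)) • dx 1) x := by
    refine hasFDerivAt_comp_coord (f := fun t => 1 / (4 * m) * (1 - 2 * m / t)) ?_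
    have h := (((hasDerivAt_inv hr).const_mul (2 * m)).const_sub 1).const_mul (1 / (4 * m))
    refine h.congr_deriv ?_
    field_simp
    norm_num
  have h : xi m = fun y => (1 / (4 * m) * (1 - 2 * m / y 1)) • dx 0 := funext xi_eq
  ext v
  rw [h, dOne_apply (A' := fun w => w 0 • ((1 / 2 * (1 / x 1 ^ 2)) • dx 1))
    (hf.smul_const (dx 0)).differentiableAt]
  · simp [wedge_apply, dx]
    ring
  · intro w
    refine (hf.smul_const (w 0)).congr_fderiv ?_
    ext
    simp [mul_comm]

theorem omega_eq {m : ℝ} (hm : 0 < m) {x : Coord} (hx : x ∈ chart m) :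
    omega m x = omegaForm x := by
  have hr : x 1 ≠ 0 := by linarith [hx.1]
  have h := hodge_smulRight hm hx (-(1 / 2) * (1 / x 1 ^ 2)) 0 (1 : ℝ)
  simp only [smulRight_one_eq, zero_smul, add_zero, zero_div, zero_add] at h
  rw [omega, dOne_xi hm hx, h, omegaForm]
  match_scalars <;> field_simp

/-! ### Derivatives and smoothness of the quaternionic sections and connections. -/

@[simp] theorem qi_re : qi.re = 0 := rfl
@[simp] theorem qi_imI : qi.imI = 1 := rfl
@[simp] theorem qi_imJ : qi.imJ = 0 := rfl
@[simp] theorem qi_imK : qi.imK = 0 := rfl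
@[simp] theorem qj_re : qj.re = 0 := rfl
@[simp] theorem qj_imI : qj.imI = 0 := rfl
@[simp] theorem qj_imJ : qj.imJ = 1 := rfl
@[simp] theorem qj_imK : qj.imK = 0 := rfl
@[simp] theorem qk_re : qk.re = 0 := rfl
@[simp] theorem qk_imI : qk.imI = 0 := rfl
@[simp] theorem qk_imJ : qk.imJ = 0 := rfl
@[simp] theorem qk_imK : qk.imK = 1 := rfl

/-- The horizontal unit section `sin(nφ) i - cos(nφ) j` of `ad P`. -/
noncomputable def horizontal (n : ℤ) (x : Coord) : ℍ[ℝ] :=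
  Real.sin (n * x 3) • qi - Real.cos (n * x 3) • qj

theorem hasFDerivAt_sin_coord (n : ℝ) (i : Fin 4) (x : Coord) :
    HasFDerivAt (fun y : Coord => Real.sin (n * y i)) ((Real.cos (n * x i) * n) • dx i) x :=
  hasFDerivAt_comp_coord (f := fun t => Real.sin (n * t)) (by
    simpa using ((hasDerivAt_id (x i)).const_mul n).sin)

theorem hasFDerivAt_cos_coord (n : ℝ) (i : Fin 4) (x : Coord) :
    HasFDerivAt (fun y : Coord => Real.cos (n * y i)) ((-Real.sin (n * x i) * n) • dx i) x :=
  hasFDerivAt_comp_coord (f := fun t => Real.cos (n * t)) (by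
    simpa using ((hasDerivAt_id (x i)).const_mul n).cos)

theorem hasFDerivAt_horizontal (n : ℤ) (x : Coord) :
    HasFDerivAt (horizontal n)
      ((dx 3).smulRight ((n : ℝ) • (Real.cos (n * x 3) • qi + Real.sin (n * x 3) • qj))) x := by
  refine (((hasFDerivAt_sin_coord n 3 x).smul_const qi).sub
    ((hasFDerivAt_cos_coord n 3 x).smul_const qj)).congr_fderiv ?_
  ext v : 1
  simp
  module

theorem hasFDerivAt_q (n : ℤ) (x : Coord) :
    HasFDerivAt (q n)
      ((dx 2).smulRight (Real.cos (x 2) • (Real.cos (n * x 3) • qi + Real.sin (n * x 3) • qj) -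
          Real.sin (x 2) • qk) -
        (dx 3).smulRight ((n * Real.sin (x 2)) • horizontal n x)) x := by
  have hs := hasFDerivAt_sin_coord 1 2 x
  have hc := hasFDerivAt_cos_coord 1 2 x
  simp only [one_mul, mul_one] at hs hc
  refine ((((hs.mul (hasFDerivAt_cos_coord n 3 x)).smul_const qi).add
    ((hs.mul (hasFDerivAt_sin_coord n 3 x)).smul_const qj)).add (hc.smul_const qk)).congr_fderiv ?_
  ext v : 1
  simp [horizontal]
  module

theorem charapDuff_apply (n : ℤ) (c : ℝ) (x v : Coord) :
    charapDuff n c x v =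
      ((n : ℝ) / 2 * ((c - 1 / x 1) * v 0 + Real.cos (x 2) * v 3)) • q n x -
        ((n : ℝ) / 2 * v 3) • qk + (1 / 2 * v 2) • horizontal n x := by
  simp [charapDuff, horizontal, dx, mul_add]

theorem abelian_apply (n : ℤ) (c : ℝ) (ε : ℤˣ) (x v : Coord) :
    abelian n c ε x v =
      ((n : ℝ) / 2 * ((c - 1 / x 1) * v 0 + (-((ε : ℤ) : ℝ) + Real.cos (x 2)) * v 3)) • qk := by
  simp [abelian, dx, mul_add]

theorem contDiff_coord (i : Fin 4) : ContDiff ℝ ∞ fun x : Coord => x i :=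
  contDiff_apply ℝ ℝ i

theorem contDiff_horizontal (n : ℤ) : ContDiff ℝ ∞ (horizontal n) := by
  unfold horizontal
  fun_prop

theorem contDiff_q (n : ℤ) : ContDiff ℝ ∞ (q n) := by
  unfold q
  fun_prop

theorem contDiffOn_inv_radius {m : ℝ} (hm : 0 < m) :
    ContDiffOn ℝ ∞ (fun x : Coord => 1 / x 1) (chart m) := by
  refine contDiffOn_const.div (contDiff_coord 1).contDiffOn fun x hx => ?_
  linarith [hx.1]

theorem contDiffOn_charapDuff {m : ℝ} (hm : 0 < m) (n : ℤ) (c : ℝ) :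
    ContDiffOn ℝ ∞ (charapDuff n c) (chart m) := by
  refine contDiffOn_clm_apply.2 fun v => ?_
  simp only [charapDuff_apply]
  have h := contDiffOn_inv_radius hm
  have h1 := (contDiff_horizontal n).contDiffOn (s := chart m)
  have h2 := (contDiff_q n).contDiffOn (s := chart m)
  have h3 := (contDiff_coord 2).contDiffOn (s := chart m)
  fun_prop

theorem contDiffOn_abelian {m : ℝ} (hm : 0 < m) (n : ℤ) (c : ℝ) (ε : ℤˣ) :
    ContDiffOn ℝ ∞ (abelian n c ε) (chart m) := by
  refine contDiffOn_clm_apply.2 fun v => ?_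
  simp only [abelian_apply]
  have h := contDiffOn_inv_radius hm
  have h3 := (contDiff_coord 2).contDiffOn (s := chart m)
  fun_prop

/-- The offset `d` is `0` for the Charap–Duff potential and `∓1` for the Abelian ones; being
constant, it drops out of the derivative. -/
theorem hasFDerivAt_potential {x : Coord} (hr : x 1 ≠ 0) (n c d a b : ℝ) :
    HasFDerivAt (fun y : Coord => n / 2 * ((c - 1 / y 1) * a + (d + Real.cos (y 2)) * b))
      ((n / 2 * a * (1 / x 1 ^ 2)) • dx 1 - (n / 2 * b * Real.sin (x 2)) • dx 2) x := by
  have hc := hasFDerivAt_cos_coord 1 2 x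
  simp only [one_mul, mul_one] at hc
  have hi : HasFDerivAt (fun y : Coord => 1 / y 1) ((-(x 1 ^ 2)⁻¹) • dx 1) x := by
    simpa using hasFDerivAt_comp_coord (f := fun t => t⁻¹) (hasDerivAt_inv hr)
  refine (((((hi.const_sub c).mul_const a).add ((hc.const_add d).mul_const b)).const_mul (n / 2))).congr_fderiv ?_
  ext v
  simp
  ring

/-! ### Curvatures. -/

theorem curvature_abelian {m : ℝ} (hm : 0 < m) (n : ℤ) (c : ℝ) (ε : ℤˣ) {x : Coord}
    (hx : x ∈ chart m) :
    curvature (abelian n c ε) x = ((n : ℝ) • omegaForm x).smulRight qk := by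
  have hr : x 1 ≠ 0 := by linarith [hx.1]
  have hA : DifferentiableAt ℝ (abelian n c ε) x :=
    ((contDiffOn_abelian hm n c ε).differentiableOn (by simp)).differentiableAt
      ((isOpen_chart m).mem_nhds hx)
  ext v : 1
  rw [curvature, ContinuousAlternatingMap.add_apply, dOne_apply
    (A' := fun w => ((n / 2 * w 0 * (1 / x 1 ^ 2)) • dx 1 -
      (n / 2 * w 3 * Real.sin (x 2)) • dx 2).smulRight qk) hA]
  -- Both values are real multiples of `k`, so `A ∧ A` cancels and only `dA` remains.
  · rw [wedge_apply, abelian_apply, abelian_apply, smul_mul_smul_comm, smul_mul_smul_comm]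
    simp [omegaForm_apply, dx]
    module
  · intro w
    simp only [abelian_apply]
    exact (hasFDerivAt_potential hr n c _ (w 0) (w 3)).smul_const qk

theorem curvature_charapDuff {m : ℝ} (hm : 0 < m) (n : ℤ) (c : ℝ) {x : Coord}
    (hx : x ∈ chart m) :
    curvature (charapDuff n c) x = ((n : ℝ) • omegaForm x).smulRight (q n x) := by
  have hr : x 1 ≠ 0 := by linarith [hx.1]
  have hA : DifferentiableAt ℝ (charapDuff n c) x :=
    ((contDiffOn_charapDuff hm n c).differentiableOn (by simp)).differentiableAt
      ((isOpen_chart m).mem_nhds hx)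
  have h : ∀ w, HasFDerivAt (fun y => charapDuff n c y w) _ x := fun w => by
    have h1 := hasFDerivAt_potential hr n c 0 (w 0) (w 3)
    simp only [zero_add] at h1
    simp only [charapDuff_apply]
    exact ((h1.smul (hasFDerivAt_q n x)).sub_const _).add
      ((hasFDerivAt_horizontal n x).const_smul (1 / 2 * w 2))
  ext v : 1
  rw [curvature, ContinuousAlternatingMap.add_apply, dOne_apply hA h, wedge_apply, charapDuff_apply,
    charapDuff_apply]
  have h1 := Real.sin_sq_add_cos_sq (n * x 3)
  have h2 := Real.sin_sq_add_cos_sq (x 2)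
  ext
  all_goals
    simp [q, horizontal, dx, omegaForm_apply]
    clear h hA
    -- The identity holds with `1/r` and `1/r²` as independent unknowns: the latter comes from `dA`,
    -- and the terms in the former cancel.
    generalize (x 1)⁻¹ = ρ
    generalize (x 1 ^ 2)⁻¹ = ρ2
    generalize (n : ℝ) = N at *
    generalize Real.sin (n * x 3) = s at *
    generalize Real.cos (n * x 3) = c at *
    generalize Real.sin (x 2) = s' at *
    generalize Real.cos (x 2) = c' at *
    grind

/-! ### Unit quaternions, exponentials and periodicity. -/

theorem norm_eq_one_of_sum_sq {a : ℍ[ℝ]}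
    (h : a.re ^ 2 + a.imI ^ 2 + a.imJ ^ 2 + a.imK ^ 2 = 1) : ‖a‖ = 1 := by
  rw [← Quaternion.normSq_def', Quaternion.normSq_eq_norm_mul_self] at h
  nlinarith [norm_nonneg a]

theorem norm_qj : ‖qj‖ = 1 := norm_eq_one_of_sum_sq (by simp)

theorem norm_qk : ‖qk‖ = 1 := norm_eq_one_of_sum_sq (by simp)

theorem q_re (n : ℤ) (x : Coord) : (q n x).re = 0 := by
  simp [q]

theorem norm_q (n : ℤ) (x : Coord) : ‖q n x‖ = 1 := by
  refine norm_eq_one_of_sum_sq ?_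
  have h1 := Real.sin_sq_add_cos_sq (n * x 3)
  have h2 := Real.sin_sq_add_cos_sq (x 2)
  simp [q]
  grind

theorem exp_smul_of_norm_eq_one {u : ℍ[ℝ]} (hre : u.re = 0) (hu : ‖u‖ = 1) (t : ℝ) :
    NormedSpace.exp (t • u) = Real.cos t • (1 : ℍ[ℝ]) + Real.sin t • u := by
  rw [Quaternion.exp_of_re_eq_zero _ (by simp [hre]), norm_smul, hu, mul_one, Real.norm_eq_abs,
    Real.cos_abs, smul_smul, show ((Real.cos t : ℝ) : ℍ[ℝ]) = Real.cos t • 1 by ext <;> simp]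
  -- At `t = 0` the quotient is `0` by convention, which is harmless because of the factor `t`.
  have h : Real.sin |t| / |t| * t = Real.sin t := by
    rcases eq_or_ne t 0 with rfl | ht
    · simp
    · rcases abs_choice t with h | h <;> rw [h]
      · field_simp
      · rw [Real.sin_neg]
        field_simp
  rw [h]

/-- There is no dependence on `τ`, and integrality of `n` makes the sine and cosine of `nφ`
invariant under `φ ↦ φ + 2π`. -/
theorem descends_of_eq {α : Type*} {m : ℝ} {f : Coord → α}
    (F : ℝ → ℝ → ℝ → ℝ → α) {n : ℤ}
    (h : ∀ x, f x = F (x 1) (x 2) (Real.sin (n * x 3)) (Real.cos (n * x 3))) : Descends m f := by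
  intro x
  have hs : Real.sin (n * (x 3 + 2 * Real.pi)) = Real.sin (n * x 3) := by
    rw [mul_add, Real.sin_add_int_mul_two_pi]
  have hc : Real.cos (n * (x 3 + 2 * Real.pi)) = Real.cos (n * x 3) := by
    rw [mul_add, Real.cos_add_int_mul_two_pi]
  constructor <;> simp [h, e, hs, hc]

theorem isUnitAdSection_q (m : ℝ) (n : ℤ) : IsUnitAdSection m (q n) where
  smooth := (contDiff_q n).contDiffOn
  imaginary := q_re n
  unit := norm_q n
  descends := descends_of_eq (fun _ Θ s c =>
    (Real.sin Θ * c) • qi + (Real.sin Θ * s) • qj + Real.cos Θ • qk) fun _ => rfl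

theorem isSU2Connection_charapDuff {m : ℝ} (hm : 0 < m) (n : ℤ) (c : ℝ) :
    IsSU2Connection m (charapDuff n c) where
  smooth := contDiffOn_charapDuff hm n c
  imaginary x v := by simp [charapDuff_apply, horizontal, q_re]
  descends := descends_of_eq (fun r Θ s t =>
    (((n : ℝ) / 2) • ((c - 1 / r) • dx 0 + Real.cos Θ • dx 3)).smulRight
      ((Real.sin Θ * t) • qi + (Real.sin Θ * s) • qj + Real.cos Θ • qk)
    - (((n : ℝ) / 2) • dx 3).smulRight qk
    + ((1 / 2 : ℝ) • dx 2).smulRight (s • qi - t • qj)) fun _ => rfl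

theorem isSU2Connection_abelian {m : ℝ} (hm : 0 < m) (n : ℤ) (c : ℝ) (ε : ℤˣ) :
    IsSU2Connection m (abelian n c ε) where
  smooth := contDiffOn_abelian hm n c ε
  imaginary x v := by simp [abelian_apply]
  descends := descends_of_eq (n := n) (fun r Θ _ _ =>
    (((n : ℝ) / 2) • ((c - 1 / r) • dx 0 +
      (-((ε : ℤ) : ℝ) + Real.cos Θ) • dx 3)).smulRight qk) fun _ => rfl

/-! ### Covariant constancy of `q_n` and reducibility. -/

theorem fderiv_q_add_bracket (n : ℤ) (c : ℝ) (x v : Coord) :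
    fderiv ℝ (q n) x v + (charapDuff n c x v * q n x - q n x * charapDuff n c x v) = 0 := by
  rw [(hasFDerivAt_q n x).fderiv, charapDuff_apply]
  have h1 := Real.sin_sq_add_cos_sq (n * x 3)
  have h2 := Real.sin_sq_add_cos_sq (x 2)
  ext
  all_goals
    simp [q, horizontal, dx]
    grind

theorem covDeriv_smul_q (n : ℤ) (c : ℝ) {f : Coord → ℝ} {x : Coord}
    (hf : DifferentiableAt ℝ f x) (v : Coord) :
    covDeriv (charapDuff n c) (fun y => f y • q n y) x v = fderiv ℝ f x v • q n x := by
  have h := fderiv_q_add_bracket n c x v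
  rw [covDeriv, fderiv_fun_smul hf (hasFDerivAt_q n x).differentiableAt]
  simp only [add_apply, smul_apply,
    ContinuousLinearMap.smulRight_apply, mul_smul_comm, smul_mul_assoc]
  rw [eq_sub_of_add_eq h]
  module

/-- The exponential is `cos f + sin f q` with `1` and `q` parallel, so its covariant derivative is
`df (-sin f + cos f q)`; now `q² = -1`. -/
theorem covDeriv_exp_smul_q (n : ℤ) (c : ℝ) {f : Coord → ℝ} {x : Coord}
    (hf : DifferentiableAt ℝ f x) (v : Coord) :
    covDeriv (charapDuff n c) (fun y => NormedSpace.exp (f y • q n y)) x v =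
      fderiv ℝ f x v • (q n x * NormedSpace.exp (f x • q n x)) := by
  have h := covDeriv_smul_q n c hf.sin v
  have hq : q n x * q n x = -1 := by
    have h1 := Quaternion.star_mul_self (q n x)
    rw [Quaternion.normSq_eq_norm_mul_self, norm_q] at h1
    have h2 : star (q n x) = -q n x := Quaternion.star_eq_neg.2 (q_re n x)
    rw [h2] at h1
    simpa [neg_eq_iff_eq_neg] using h1
  have hc : HasFDerivAt (fun y => Real.cos (f y) • (1 : ℍ[ℝ]))
      ((-Real.sin (f x) • fderiv ℝ f x).smulRight (1 : ℍ[ℝ])) x :=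
    hf.hasFDerivAt.cos.smul_const _
  have hs : DifferentiableAt ℝ (fun y => Real.sin (f y) • q n y) x :=
    hf.sin.smul (hasFDerivAt_q n x).differentiableAt
  simp only [exp_smul_of_norm_eq_one (q_re n _) (norm_q n _)]
  rw [covDeriv] at h ⊢
  rw [fderiv_fun_add hc.differentiableAt hs, hc.fderiv]
  rw [hf.hasFDerivAt.sin.fderiv] at h
  simp only [add_apply, smul_apply,
    ContinuousLinearMap.smulRight_apply, mul_add, add_mul, mul_smul_comm, smul_mul_assoc, mul_one,
    one_mul, hq, smul_eq_mul] at h ⊢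
  rw [← sub_eq_zero] at h ⊢
  rw [← h]
  module

/-- Put `B = s⁻¹ A s + s⁻¹ ds`. Differentiating `s k = q s` and using `∇ q = 0` shows that `B`
commutes with `k`; differentiating `|s|² = 1` shows that `B` is imaginary. Such a quaternion lies in
`ℝ k`. -/
theorem reducesTo_q (m : ℝ) (n : ℤ) (c : ℝ) : ReducesTo m (charapDuff n c) (q n) := by
  intro O hO _ s hs hsO x hx v
  have hd : DifferentiableAt ℝ s x :=
    (hs.differentiableOn (by simp)).differentiableAt (hO.mem_nhds hx)
  have hne : ∀ y ∈ O, s y ≠ 0 := fun y hy h0 => by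
    have := (hsO y hy).1
    simp [h0] at this
  have hcomm : (fun y => s y * qk) =ᶠ[nhds x] fun y => q n y * s y := by
    filter_upwards [hO.mem_nhds hx] with y hy
    rw [← (hsO y hy).2, mul_assoc, inv_mul_cancel₀ (hne y hy), mul_one]
  have hunit : (fun y => ‖s y‖ ^ 2) =ᶠ[nhds x] fun _ => 1 := by
    filter_upwards [hO.mem_nhds hx] with y hy
    simp [(hsO y hy).1]
  have h1 : fderiv ℝ s x v * qk = q n x * fderiv ℝ s x v + fderiv ℝ (q n) x v * s x := by
    have h := congrArg (fun L : Coord →L[ℝ] ℍ[ℝ] => L v) hcomm.fderiv_eq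
    rw [(hd.hasFDerivAt.mul_const' qk).fderiv,
      ((hasFDerivAt_q n x).differentiableAt.hasFDerivAt.fun_mul' hd.hasFDerivAt).fderiv] at h
    simpa using h
  have h2 : (star (s x) * fderiv ℝ s x v).re = 0 := by
    have h := congrArg (fun L : Coord →L[ℝ] ℝ => L v) hunit.fderiv_eq
    rw [hd.hasFDerivAt.norm_sq.fderiv] at h
    simp [Quaternion.inner_def] at h
    simp
    linarith
  have hq := eq_neg_of_add_eq_zero_left (fderiv_q_add_bracket n c x v)
  -- The real part does not involve the mass, so the value `m = 1` may be used.
  have hA : (charapDuff n c x v).re = 0 := (isSU2Connection_charapDuff one_pos n c).imaginary x v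
  have hx0 : s x * qk = q n x * s x := hcomm.eq_of_nhds
  have hinv : (s x)⁻¹ * s x = 1 := inv_mul_cancel₀ (hne x hx)
  have hinv' : s x * (s x)⁻¹ = 1 := mul_inv_cancel₀ (hne x hx)
  have hstar : (s x)⁻¹ = star (s x) := by
    refine inv_eq_of_mul_eq_one_left ?_
    rw [Quaternion.star_mul_self, Quaternion.normSq_eq_norm_mul_self, (hsO x hx).1]
    simp
  have hk : qk * (s x)⁻¹ = (s x)⁻¹ * q n x := by
    rw [← (hsO x hx).2, ← mul_assoc, ← mul_assoc, hinv, one_mul]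
  have hB : gaugeTransform (fun y => (s y)⁻¹) (charapDuff n c) x v =
      (s x)⁻¹ * charapDuff n c x v * s x + (s x)⁻¹ * fderiv ℝ s x v := by
    simp [gaugeTransform]
  rw [hB]
  generalize fderiv ℝ s x v = d at *
  generalize charapDuff n c x v = a at *
  have hcommB : ((s x)⁻¹ * a * s x + (s x)⁻¹ * d) * qk =
      qk * ((s x)⁻¹ * a * s x + (s x)⁻¹ * d) := by
    calc _ = (s x)⁻¹ * a * (s x * qk) + (s x)⁻¹ * (d * qk) := by noncomm_ring
      _ = (s x)⁻¹ * q n x * a * s x + (s x)⁻¹ * q n x * d := by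
        rw [hx0, h1, hq]
        noncomm_ring
      _ = _ := by
        rw [← hk]
        noncomm_ring
  have hreB : ((s x)⁻¹ * a * s x + (s x)⁻¹ * d).re = 0 := by
    have h3 : ((s x)⁻¹ * a * s x).re = (s x * (s x)⁻¹ * a).re := by
      simp only [Quaternion.re_mul, Quaternion.imI_mul, Quaternion.imJ_mul, Quaternion.imK_mul]
      ring
    rw [Quaternion.re_add, h3, hinv', one_mul, hA, hstar, h2, add_zero]
  generalize (s x)⁻¹ * a * s x + (s x)⁻¹ * d = B at *
  have hI := congrArg (fun z => z.imI) hcommB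
  have hJ := congrArg (fun z => z.imJ) hcommB
  refine ⟨B.imK, ?_⟩
  simp at hI hJ
  ext
  · simpa using hreB
  · simp
    linarith
  · simp
    linarith
  · simp

/-! ### The Pontryagin number. -/

theorem curvature_charapDuff_eq {m : ℝ} (hm : 0 < m) (n : ℤ) (c : ℝ) {x : Coord}
    (hx : x ∈ chart m) :
    curvature (charapDuff n c) x = ((n : ℝ) • omega m x).smulRight (q n x) := by
  rw [omega_eq hm hx, curvature_charapDuff hm n c hx]

theorem pontryaginDensity_charapDuff {m : ℝ} (hm : 0 < m) (n : ℤ) (c : ℝ) {x : Coord}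
    (hx : x ∈ chart m) :
    pontryaginDensity (charapDuff n c) x =
      (n : ℝ) ^ 2 / (8 * Real.pi ^ 2) * ((1 / x 1 ^ 2) * Real.sin (x 2)) := by
  have hr : x 1 ≠ 0 := by linarith [hx.1]
  have h1 := Real.sin_sq_add_cos_sq (n * x 3)
  have h2 := Real.sin_sq_add_cos_sq (x 2)
  have hq : (q n x * q n x).re = -1 := by
    simp [q]
    grind
  rw [pontryaginDensity, su2Trace, wedgeCoeff, curvature_charapDuff hm n c hx,
    sum_sign_smul_perm_fin_four (fun i j k l =>
      (((n : ℝ) • omegaForm x).smulRight (q n x)) ![e i, e j] *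
        (((n : ℝ) • omegaForm x).smulRight (q n x)) ![e k, e l])]
  simp only [ContinuousAlternatingMap.smulRight_apply, ContinuousAlternatingMap.smul_apply,
    omegaForm_apply, smul_mul_smul_comm, ← sub_smul, ← add_smul, Quaternion.re_smul, hq]
  simp [e]
  field_simp
  ring

/-- The factors of the Pontryagin density as a product of functions of one coordinate. -/
noncomputable def densityFactor (n : ℤ) : Fin 4 → ℝ → ℝ :=
  ![fun _ => (n : ℝ) ^ 2 / (8 * Real.pi ^ 2), fun r => 1 / r ^ 2, Real.sin, fun _ => 1]

/-- The sides of the fundamental domain. -/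
def domainSide (m : ℝ) : Fin 4 → Set ℝ :=
  ![Set.Ioo 0 (8 * Real.pi * m), Set.Ioi (2 * m), Set.Ioo 0 Real.pi, Set.Ioo 0 (2 * Real.pi)]

theorem fundamentalDomain_eq_pi (m : ℝ) : fundamentalDomain m = Set.univ.pi (domainSide m) := by
  ext x
  simp [fundamentalDomain, domainSide, Fin.forall_fin_succ]

theorem measurableSet_domainSide (m : ℝ) (i : Fin 4) : MeasurableSet (domainSide m i) := by
  fin_cases i
  exacts [measurableSet_Ioo, measurableSet_Ioi, measurableSet_Ioo, measurableSet_Ioo]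

theorem measurableSet_fundamentalDomain (m : ℝ) : MeasurableSet (fundamentalDomain m) := by
  rw [fundamentalDomain_eq_pi]
  exact MeasurableSet.univ_pi (measurableSet_domainSide m)

theorem pontryaginDensity_eqOn {m : ℝ} (hm : 0 < m) (n : ℤ) (c : ℝ) :
    Set.EqOn (pontryaginDensity (charapDuff n c)) (fun x => ∏ i, densityFactor n i (x i))
      (fundamentalDomain m) := by
  intro x hx
  simp only [pontryaginDensity_charapDuff hm n c ⟨hx.2.1, hx.2.2.1⟩, Fin.prod_univ_four]
  simp [densityFactor]
  ring

theorem volume_restrict_fundamentalDomain (m : ℝ) :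
    (MeasureTheory.volume : MeasureTheory.Measure Coord).restrict (fundamentalDomain m) =
      MeasureTheory.Measure.pi fun i => MeasureTheory.volume.restrict (domainSide m i) := by
  rw [fundamentalDomain_eq_pi, MeasureTheory.volume_pi, MeasureTheory.Measure.restrict_pi_pi]

theorem integrableOn_one_div_sq {a : ℝ} (ha : 0 < a) :
    MeasureTheory.IntegrableOn (fun r : ℝ => 1 / r ^ 2) (Set.Ioi a) := by
  have h := integrableOn_Ioi_rpow_of_lt (a := -2) (by norm_num) ha
  refine h.congr_fun (fun r hr => ?_) measurableSet_Ioi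
  have hr : 0 < r := ha.trans hr
  simp [Real.rpow_neg hr.le]

theorem integral_one_div_sq {a : ℝ} (ha : 0 < a) :
    ∫ r in Set.Ioi a, 1 / r ^ 2 = 1 / a := by
  have h := integral_Ioi_rpow_of_lt (a := -2) (by norm_num) ha
  rw [MeasureTheory.setIntegral_congr_fun (g := fun r : ℝ => r ^ (-2 : ℝ)) measurableSet_Ioi, h]
  · norm_num [Real.rpow_neg_one]
  · intro r hr
    have hr : 0 < r := ha.trans hr
    simp [Real.rpow_neg hr.le]

theorem integrableOn_pontryaginDensity {m : ℝ} (hm : 0 < m) (n : ℤ) (c : ℝ) :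
    MeasureTheory.IntegrableOn (pontryaginDensity (charapDuff n c)) (fundamentalDomain m) := by
  refine MeasureTheory.IntegrableOn.congr_fun ?_ (pontryaginDensity_eqOn hm n c).symm
    (measurableSet_fundamentalDomain m)
  rw [MeasureTheory.IntegrableOn, volume_restrict_fundamentalDomain]
  refine MeasureTheory.Integrable.fintype_prod fun i => ?_
  fin_cases i
  · exact MeasureTheory.integrableOn_const (by simp [domainSide])
  · exact integrableOn_one_div_sq (by positivity)
  · exact (Real.continuous_sin.integrableOn_Icc).mono_set Set.Ioo_subset_Icc_self
  · exact MeasureTheory.integrableOn_const (by simp [domainSide, ENNReal.mul_eq_top])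

theorem integral_pontryaginDensity {m : ℝ} (hm : 0 < m) (n : ℤ) (c : ℝ) :
    ∫ x in fundamentalDomain m, pontryaginDensity (charapDuff n c) x = 2 * (n : ℝ) ^ 2 := by
  rw [MeasureTheory.setIntegral_congr_fun (measurableSet_fundamentalDomain m)
    (pontryaginDensity_eqOn hm n c), volume_restrict_fundamentalDomain,
    MeasureTheory.integral_fintype_prod_eq_prod, Fin.prod_univ_four]
  have h0 : 0 ≤ 8 * Real.pi * m := by positivity
  have h1 : 0 ≤ 2 * Real.pi := by positivity
  have hs : ∫ t in Set.Ioo 0 Real.pi, Real.sin t = 2 := by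
    rw [← MeasureTheory.integral_Ioc_eq_integral_Ioo,
      ← intervalIntegral.integral_of_le Real.pi_pos.le, integral_sin]
    norm_num
  have hr := integral_one_div_sq (a := 2 * m) (by positivity)
  -- The four integrals are `n² m / π`, `1 / (2m)`, `2` and `2π`, so the mass cancels.
  simp only [domainSide, densityFactor, Matrix.cons_val] at hr ⊢
  rw [hs, hr]
  simp [h0, h1]
  field_simp

/-! ### Magnetic and electric charges. -/

theorem charge_eq {m : ℝ} (n : ℤ) {Φ : Coord → TwoForm ℝ}
    (h : ∀ x ∈ chart m, Φ x = (n : ℝ) • omegaForm x) (τ : ℝ) {r : ℝ} (hr : 2 * m < r) :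
    charge Φ τ r = n := by
  have hin : ∀ φ : ℝ, ∫ Θ in (0 : ℝ)..Real.pi, Φ ![τ, r, Θ, φ] ![e 2, e 3] = -n := by
    intro φ
    -- The formula for `Φ` is available only inside the chart, hence the open interval without the
    -- poles.
    rw [intervalIntegral.integral_congr_Ioo_of_le (g := fun Θ => -(n : ℝ) / 2 * Real.sin Θ)
      Real.pi_pos.le]
    · rw [intervalIntegral.integral_const_mul, integral_sin]
      norm_num
    · intro Θ hΘ
      have hx : ![τ, r, Θ, φ] ∈ chart m := ⟨hr, hΘ.1, hΘ.2⟩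
      simp only [h _ hx, ContinuousAlternatingMap.smul_apply, omegaForm_apply]
      simp [e]
      ring
  rw [charge]
  simp only [hin, intervalIntegral.integral_const]
  simp
  field_simp

theorem fieldStrength_eq {m : ℝ} (n : ℤ) {u : Coord → ℍ[ℝ]} {F : Coord → TwoForm ℍ[ℝ]}
    (hu : ∀ x, ‖u x‖ = 1)
    (h : ∀ x ∈ chart m, F x = ((n : ℝ) • omegaForm x).smulRight (u x)) {x : Coord}
    (hx : x ∈ chart m) : fieldStrength u F x = (n : ℝ) • omegaForm x := by
  ext v
  rw [fieldStrength, h x hx]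
  simp [real_inner_smul_right, hu]

theorem charges_eq {m : ℝ} (hm : 0 < m) (n : ℤ) {u : Coord → ℍ[ℝ]} {F : Coord → TwoForm ℍ[ℝ]}
    (hu : ∀ x, ‖u x‖ = 1)
    (h : ∀ x ∈ chart m, F x = ((n : ℝ) • omegaForm x).smulRight (u x)) (τ : ℝ) {r : ℝ}
    (hr : 2 * m < r) :
    magneticCharge (fieldStrength u F) τ r = n ∧ electricCharge m (fieldStrength u F) τ r = n := by
  refine ⟨charge_eq n (fun x hx => fieldStrength_eq n hu h hx) τ hr,
    charge_eq n (fun x hx => ?_) τ hr⟩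
  rw [fieldStrength_eq n hu h hx, hodge_omegaForm hm hx]

/-! ### The gauge transformations. -/

/-- Conjugation by `exp(k nφ/2)` rotates `-j` through the angle `nφ` to the horizontal section, so
half-angles of `nφ` disappear. -/
theorem gauge_one (n : ℤ) (x : Coord) :
    gauge n 1 x = Real.cos (x 2 / 2) • (1 : ℍ[ℝ]) + Real.sin (x 2 / 2) • horizontal n x := by
  obtain ⟨α, hα⟩ : ∃ α, α = n * x 3 / 2 := ⟨_, rfl⟩
  have h2 : (n : ℝ) * x 3 = 2 * α := by rw [hα]; ring
  have h1 := Real.sin_sq_add_cos_sq α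
  simp only [gauge, exp_smul_of_norm_eq_one (show qk.re = 0 from rfl) norm_qk,
    exp_smul_of_norm_eq_one (show qj.re = 0 from rfl) norm_qj, horizontal, h2, Real.sin_two_mul,
    Real.cos_two_mul]
  ext <;> simp <;> grind

/-- Since `j` anticommutes with `k`, the two outer factors cancel on the `j` term and combine to
`exp(-k nφ)` on the scalar term. -/
theorem gauge_neg_one (n : ℤ) (x : Coord) :
    gauge n (-1) x = (Real.cos (x 2 / 2) * Real.cos (n * x 3)) • (1 : ℍ[ℝ]) -
      Real.sin (x 2 / 2) • qj - (Real.cos (x 2 / 2) * Real.sin (n * x 3)) • qk := by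
  obtain ⟨α, hα⟩ : ∃ α, α = n * x 3 / 2 := ⟨_, rfl⟩
  have h2 : (n : ℝ) * x 3 = 2 * α := by rw [hα]; ring
  have h1 := Real.sin_sq_add_cos_sq α
  simp only [gauge, exp_smul_of_norm_eq_one (show qk.re = 0 from rfl) norm_qk,
    exp_smul_of_norm_eq_one (show qj.re = 0 from rfl) norm_qj, h2, Real.sin_two_mul,
    Real.cos_two_mul]
  ext <;> simp <;> grind

theorem gauge_one_eq_exp_mul (n : ℤ) (x : Coord) :
    gauge n 1 x = NormedSpace.exp ((n * x 3) • qk) * gauge n (-1) x := by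
  have h1 := Real.sin_sq_add_cos_sq (n * x 3)
  rw [gauge_one, gauge_neg_one, exp_smul_of_norm_eq_one (show qk.re = 0 from rfl) norm_qk]
  ext <;> simp [horizontal] <;> grind

theorem norm_gauge (n : ℤ) (ε : ℤˣ) (x : Coord) : ‖gauge n ε x‖ = 1 := by
  have h (u : ℍ[ℝ]) (hre : u.re = 0) (hu : ‖u‖ = 1) (t : ℝ) : ‖NormedSpace.exp (t • u)‖ = 1 := by
    rw [Quaternion.norm_exp]
    simp [hre]
  rw [gauge, norm_mul, norm_mul, h _ rfl norm_qk, h _ rfl norm_qj, h _ rfl norm_qk, one_mul, one_mul]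

theorem gauge_ne_zero (n : ℤ) (ε : ℤˣ) (x : Coord) : gauge n ε x ≠ 0 := by
  rw [← norm_ne_zero_iff, norm_gauge]
  exact one_ne_zero

theorem contDiff_gauge (n : ℤ) (ε : ℤˣ) : ContDiff ℝ ∞ (gauge n ε) := by
  have h := contDiff_horizontal n
  rcases Int.units_eq_one_or ε with rfl | rfl
  · rw [funext (gauge_one n)]
    fun_prop
  · rw [funext (gauge_neg_one n)]
    fun_prop

theorem isGaugeTransformation_gauge (m : ℝ) (n : ℤ) (ε : ℤˣ) :
    IsGaugeTransformation m (gauge n ε) where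
  smooth := (contDiff_gauge n ε).contDiffOn
  unit := norm_gauge n ε
  descends := by
    rcases Int.units_eq_one_or ε with rfl | rfl
    · exact descends_of_eq (fun _ Θ s c => Real.cos (Θ / 2) • (1 : ℍ[ℝ]) +
        Real.sin (Θ / 2) • (s • qi - c • qj)) (gauge_one n)
    · exact descends_of_eq (fun _ Θ s c => (Real.cos (Θ / 2) * c) • (1 : ℍ[ℝ]) -
        Real.sin (Θ / 2) • qj - (Real.cos (Θ / 2) * s) • qk) (gauge_neg_one n)

theorem exists_half_angle (t : ℝ) : ∃ s c : ℝ, s ^ 2 + c ^ 2 = 1 ∧ Real.sin (t / 2) = s ∧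
    Real.cos (t / 2) = c ∧ Real.sin t = 2 * s * c ∧ Real.cos t = 2 * c ^ 2 - 1 := by
  have h : t = 2 * (t / 2) := by ring
  refine ⟨_, _, Real.sin_sq_add_cos_sq (t / 2), rfl, rfl, ?_, ?_⟩
  · conv_lhs => rw [h, Real.sin_two_mul]
  · conv_lhs => rw [h, Real.cos_two_mul]

theorem gauge_mul_q (n : ℤ) (ε : ℤˣ) (x : Coord) :
    gauge n ε x * q n x = qk * gauge n ε x := by
  have h1 := Real.sin_sq_add_cos_sq (n * x 3)
  obtain ⟨s, c, h2, hs, hc, hs', hc'⟩ := exists_half_angle (x 2)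
  rcases Int.units_eq_one_or ε with rfl | rfl
  · rw [gauge_one]
    ext <;> simp [horizontal, q, hs, hc, hs', hc'] <;> grind
  · rw [gauge_neg_one]
    ext <;> simp [q, hs, hc, hs', hc'] <;> grind

theorem hasFDerivAt_half_angle (x : Coord) :
    HasFDerivAt (fun y : Coord => Real.sin (y 2 / 2)) ((Real.cos (x 2 / 2) * (1 / 2)) • dx 2) x ∧
    HasFDerivAt (fun y : Coord => Real.cos (y 2 / 2))
      ((-Real.sin (x 2 / 2) * (1 / 2)) • dx 2) x :=
  ⟨hasFDerivAt_comp_coord (f := fun t => Real.sin (t / 2))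
    (((hasDerivAt_id (x 2)).div_const 2).sin),
   hasFDerivAt_comp_coord (f := fun t => Real.cos (t / 2))
    (((hasDerivAt_id (x 2)).div_const 2).cos)⟩

/-- This is the gauge law multiplied on the right by `g`, using `g d(g⁻¹) = -dg g⁻¹`; free of
inverses, it is a polynomial identity in sines and cosines. -/
theorem gauge_mul_charapDuff_sub (n : ℤ) (c : ℝ) (ε : ℤˣ) (x v : Coord) :
    gauge n ε x * charapDuff n c x v - fderiv ℝ (gauge n ε) x v =
      abelian n c ε x v * gauge n ε x := by
  have h1 := Real.sin_sq_add_cos_sq (n * x 3)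
  obtain ⟨hsd, hcd⟩ := hasFDerivAt_half_angle x
  obtain ⟨s, c, h2, hs, hc, hs', hc'⟩ := exists_half_angle (x 2)
  rw [charapDuff_apply, abelian_apply]
  rcases Int.units_eq_one_or ε with rfl | rfl
  · rw [funext (gauge_one n), ((hcd.smul_const (1 : ℍ[ℝ])).fun_add
      (hsd.fun_smul (hasFDerivAt_horizontal n x))).fderiv]
    clear hsd hcd
    ext <;> simp [horizontal, q, dx, hs, hc, hs', hc'] <;> grind
  · rw [funext (gauge_neg_one n), ((((hcd.fun_mul (hasFDerivAt_cos_coord n 3 x)).smul_const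
      (1 : ℍ[ℝ])).fun_sub (hsd.smul_const qj)).fun_sub
        ((hcd.fun_mul (hasFDerivAt_sin_coord n 3 x)).smul_const qk)).fderiv]
    clear hsd hcd
    ext <;> simp [horizontal, q, dx, hs, hc, hs', hc'] <;> grind

theorem gaugeTransform_apply {g : Coord → ℍ[ℝ]} {A : Coord → Coord →L[ℝ] ℍ[ℝ]} {x : Coord}
    (hg : DifferentiableAt ℝ g x) (h0 : g x ≠ 0) (v : Coord) :
    gaugeTransform g A x v = (g x * A x v - fderiv ℝ g x v) * (g x)⁻¹ := by
  have h : HasFDerivAt (fun y => (g y)⁻¹) _ x := (hasFDerivAt_inv' h0).comp x hg.hasFDerivAt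
  simp [gaugeTransform, h.fderiv, sub_eq_add_neg, add_mul, ← mul_assoc, h0]

theorem gaugeTransform_gauge_charapDuff (n : ℤ) (c : ℝ) (ε : ℤˣ) (x : Coord) :
    gaugeTransform (gauge n ε) (charapDuff n c) x = abelian n c ε x := by
  ext v : 1
  rw [gaugeTransform_apply ((contDiff_gauge n ε).differentiable (by simp) x)
    (gauge_ne_zero n ε x), gauge_mul_charapDuff_sub, mul_inv_cancel_right₀ (gauge_ne_zero n ε x)]

theorem gauge_mul_q_mul_inv (n : ℤ) (ε : ℤˣ) (x : Coord) :
    gauge n ε x * q n x * (gauge n ε x)⁻¹ = qk := by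
  rw [gauge_mul_q, mul_inv_cancel_right₀ (gauge_ne_zero n ε x)]

theorem abelian_one_eq_sub (n : ℤ) (c : ℝ) (x : Coord) :
    abelian n c 1 x = abelian n c (-1) x - ((n : ℝ) • dx 3).smulRight qk := by
  ext v : 1
  rw [sub_apply, abelian_apply, abelian_apply]
  simp [dx]
  module

/-! ### Analytic extension across a pole. -/

/-- The cosine (for `ε = 1`) or sine (for `ε = -1`) of half the polar angle of `y`. -/
noncomputable def halfAngle (ε : ℝ) (y : EuclideanSpace ℝ (Fin 3)) : ℝ :=
  Real.sqrt ((‖y‖ + ε * y 2) / (2 * ‖y‖))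

/-- The gauge transformations in Cartesian coordinates. -/
noncomputable def cartesianGauge (ε : ℤˣ) (y : EuclideanSpace ℝ (Fin 3)) : ℍ[ℝ] :=
  if ε = 1 then halfAngle 1 y • (1 : ℍ[ℝ]) + (y 1 / (2 * ‖y‖ * halfAngle 1 y)) • qi -
      (y 0 / (2 * ‖y‖ * halfAngle 1 y)) • qj
    else (y 0 / (2 * ‖y‖ * halfAngle (-1) y)) • (1 : ℍ[ℝ]) - halfAngle (-1) y • qj -
      (y 1 / (2 * ‖y‖ * halfAngle (-1) y)) • qk

/-- The excluded ray contains the origin and is exactly where `|y| + ε y₃` vanishes. Off it the norm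
is analytic, the radicand is positive and no denominator vanishes. -/
theorem analyticOnNhd_cartesianGauge (ε : ℤˣ) :
    AnalyticOnNhd ℝ (cartesianGauge ε) {y | ((ε : ℤ) : ℝ) * y 2 ≠ -‖y‖} := by
  intro y hy
  have hy0 : y ≠ 0 := by
    rintro rfl
    simp at hy
  have hn : 0 < ‖y‖ := norm_pos_iff.2 hy0
  have hnorm : ContDiffAt ℝ ω (fun z : EuclideanSpace ℝ (Fin 3) => ‖z‖) y := contDiffAt_norm ℝ hy0
  have hc (i : Fin 3) : ContDiffAt ℝ ω (fun z : EuclideanSpace ℝ (Fin 3) => z i) y :=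
    (contDiff_euclidean.1 contDiff_id i).contDiffAt
  have hle : |y 2| ≤ ‖y‖ := by simpa using PiLp.norm_apply_le y 2
  have hpos : ∀ δ : ℝ, |δ| = 1 → δ * y 2 ≠ -‖y‖ → 0 < (‖y‖ + δ * y 2) / (2 * ‖y‖) := by
    intro δ hδ h
    have h1 : |δ * y 2| ≤ ‖y‖ := by rw [abs_mul, hδ, one_mul]; exact hle
    have h2 : -‖y‖ < δ * y 2 := lt_of_le_of_ne (abs_le.1 h1).1 h.symm
    have h3 : 0 < ‖y‖ + δ * y 2 := by linarith
    positivity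
  have hd : ContDiffAt ℝ ω (fun z : EuclideanSpace ℝ (Fin 3) => 2 * ‖z‖) y :=
    contDiffAt_const.mul hnorm
  have hhalf : ∀ δ : ℝ, |δ| = 1 → δ * y 2 ≠ -‖y‖ →
      ContDiffAt ℝ ω (halfAngle δ) y ∧ 2 * ‖y‖ * halfAngle δ y ≠ 0 := fun δ hδ h =>
    ⟨((hnorm.add (contDiffAt_const.mul (hc 2))).div hd (by positivity)).sqrt (hpos δ hδ h).ne',
      mul_ne_zero (by positivity) (Real.sqrt_pos.2 (hpos δ hδ h)).ne'⟩
  refine ContDiffAt.analyticAt ?_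
  rcases Int.units_eq_one_or ε with rfl | rfl
  · obtain ⟨h1, h2⟩ := hhalf 1 (by simp) (by simpa using hy)
    change ContDiffAt ℝ ω (fun z => cartesianGauge 1 z) y
    simp only [cartesianGauge, if_true]
    exact ((h1.smul contDiffAt_const).add (((hc 1).div (hd.mul h1) h2).smul contDiffAt_const)).sub
      (((hc 0).div (hd.mul h1) h2).smul contDiffAt_const)
  · obtain ⟨h1, h2⟩ := hhalf (-1) (by simp) (by simpa using hy)
    change ContDiffAt ℝ ω (fun z => cartesianGauge (-1) z) y
    simp only [cartesianGauge, if_neg (show (-1 : ℤˣ) ≠ 1 by decide)]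
    exact ((((hc 0).div (hd.mul h1) h2).smul contDiffAt_const).sub (h1.smul contDiffAt_const)).sub
      (((hc 1).div (hd.mul h1) h2).smul contDiffAt_const)

theorem norm_cartesian (n : ℤ) {x : Coord} (hx : 0 ≤ x 1) : ‖cartesian n x‖ = x 1 := by
  rw [EuclideanSpace.norm_eq, Real.sqrt_eq_iff_mul_self_eq (by positivity) hx]
  have h1 := Real.sin_sq_add_cos_sq (n * x 3)
  have h2 := Real.sin_sq_add_cos_sq (x 2)
  simp [cartesian, Fin.sum_univ_three]
  grind

/-- The radicand `(1 ± cos Θ)/2` is the square of `cos (Θ/2)` or `sin (Θ/2)`, both nonnegative on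
`[0, π]`. The other half-angle function is `sin Θ` divided by twice this one, which `hε` keeps
nonzero. -/
theorem gauge_eq_cartesianGauge (n : ℤ) (ε : ℤˣ) {x : Coord} (hr : 0 < x 1)
    (hΘ : x 2 ∈ Set.Icc 0 Real.pi) (hε : ((ε : ℤ) : ℝ) * Real.cos (x 2) ≠ -1) :
    gauge n ε x = cartesianGauge ε (cartesian n x) := by
  have hs0 : 0 ≤ Real.sin (x 2 / 2) :=
    Real.sin_nonneg_of_nonneg_of_le_pi (by linarith [hΘ.1]) (by linarith [hΘ.2, Real.pi_pos])
  have hc0 : 0 ≤ Real.cos (x 2 / 2) :=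
    Real.cos_nonneg_of_neg_pi_div_two_le_of_le (by linarith [hΘ.1, Real.pi_pos])
      (by linarith [hΘ.2])
  obtain ⟨s, c, h2, hs, hc, hs', hc'⟩ := exists_half_angle (x 2)
  have hne := hr.ne'
  have hnorm := norm_cartesian n hr.le
  have e0 : cartesian n x 0 = x 1 * Real.sin (x 2) * Real.cos (n * x 3) := rfl
  have e1 : cartesian n x 1 = x 1 * Real.sin (x 2) * Real.sin (n * x 3) := rfl
  have e2 : cartesian n x 2 = x 1 * Real.cos (x 2) := rfl
  rw [hs] at hs0
  rw [hc] at hc0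
  rcases Int.units_eq_one_or ε with rfl | rfl
  · have hcne : c ≠ 0 := by
      rintro rfl
      simp [hc'] at hε
    have hh : halfAngle 1 (cartesian n x) = c := by
      rw [halfAngle, hnorm, e2, hc', ← Real.sqrt_sq hc0]
      congr 1
      field_simp
      rw [Real.sqrt_sq hc0]
      ring
    simp only [cartesianGauge, if_true, hh, hnorm, e0, e1, gauge_one, horizontal, hs, hc, hs']
    match_scalars <;> field_simp
  · have hsne : s ≠ 0 := by
      rintro rfl
      simp [hc'] at hε
      grind
    have hh : halfAngle (-1) (cartesian n x) = s := by
      rw [halfAngle, hnorm, e2, hc', ← Real.sqrt_sq hs0]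
      congr 1
      field_simp
      linarith
    simp only [cartesianGauge, if_neg (show (-1 : ℤˣ) ≠ 1 by decide), hh, hnorm, e0, e1,
      gauge_neg_one, hs, hc, hs']
    match_scalars <;> field_simp

end CharapDuff

theorem mainTheorem3 (m : ℝ) (hm : 0 < m) (c : ℝ) (n : ℤ) :
    -- the explicit form of the self-dual two-form on the chart
    (∀ x ∈ chart m, omega m x = (-(1 / 2) : ℝ) •
      ((1 / x 1 ^ 2) • wedge (dx 0) (dx 1) + Real.sin (x 2) • wedge (dx 2) (dx 3))) ∧
    -- self-dual `SU(2)`-connections with curvature `n ω q_n` and Pontryagin number `2n²`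
    IsSU2Connection m (charapDuff n c) ∧
    (∀ x ∈ chart m, curvature (charapDuff n c) x = ((n : ℝ) • omega m x).smulRight (q n x)) ∧
    (∀ x ∈ chart m, hodge (metric m x) (curvature (charapDuff n c) x) =
      curvature (charapDuff n c) x) ∧
    MeasureTheory.IntegrableOn (pontryaginDensity (charapDuff n c)) (fundamentalDomain m) ∧
    (∫ x in fundamentalDomain m, pontryaginDensity (charapDuff n c) x = 2 * (n : ℝ) ^ 2) ∧
    -- the `U(1)`-subbundle generated by `q_n` is preserved, and the connection is reducible
    IsUnitAdSection m (q n) ∧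
    (∀ f : Coord → ℝ, ContDiffOn ℝ ∞ f (chart m) → ∀ x ∈ chart m, ∀ v,
      covDeriv (charapDuff n c) (fun y => f y • q n y) x v = fderiv ℝ f x v • q n x ∧
      covDeriv (charapDuff n c) (fun y => NormedSpace.exp (f y • q n y)) x v =
        fderiv ℝ f x v • (q n x * NormedSpace.exp (f x • q n x))) ∧
    ReducesTo m (charapDuff n c) (q n) ∧
    -- the gauge transformations `g_n^±` carry the connection to the Abelian ones
    (∀ ε : ℤˣ, IsGaugeTransformation m (gauge n ε) ∧
      (∃ G : EuclideanSpace ℝ (Fin 3) → ℍ[ℝ],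
        AnalyticOnNhd ℝ G {y | ((ε : ℤ) : ℝ) * y 2 ≠ -‖y‖} ∧
        ∀ x : Coord, 2 * m ≤ x 1 → x 2 ∈ Set.Icc 0 Real.pi →
          ((ε : ℤ) : ℝ) * Real.cos (x 2) ≠ -1 → gauge n ε x = G (cartesian n x)) ∧
      (∀ x, gauge n ε x * q n x * (gauge n ε x)⁻¹ = qk) ∧
      IsSU2Connection m (abelian n c ε) ∧
      (∀ x ∈ chart m, gaugeTransform (gauge n ε) (charapDuff n c) x = abelian n c ε x) ∧
      (∀ x ∈ chart m, curvature (abelian n c ε) x = ((n : ℝ) • omega m x).smulRight qk)) ∧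
    -- the two gauges differ by the transition function `exp(k nφ)`
    (∀ x, gauge n 1 x = NormedSpace.exp ((n * x 3) • qk) * gauge n (-1) x) ∧
    (∀ x, abelian n c 1 x = abelian n c (-1) x - ((n : ℝ) • dx 3).smulRight qk) ∧
    -- magnetic and electric charge `n`
    (∀ τ r : ℝ, 2 * m < r →
      magneticCharge (fieldStrength (q n) (curvature (charapDuff n c))) τ r = n ∧
      electricCharge m (fieldStrength (q n) (curvature (charapDuff n c))) τ r = n ∧
      ∀ ε : ℤˣ,
        magneticCharge (fieldStrength (fun _ => qk) (curvature (abelian n c ε))) τ r = n ∧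
        electricCharge m (fieldStrength (fun _ => qk) (curvature (abelian n c ε))) τ r = n) := by
  refine ⟨fun x hx => omega_eq hm hx, isSU2Connection_charapDuff hm n c,
    fun x hx => curvature_charapDuff_eq hm n c hx, fun x hx => ?_,
    integrableOn_pontryaginDensity hm n c, integral_pontryaginDensity hm n c,
    isUnitAdSection_q m n, fun f hf x hx v => ?_, reducesTo_q m n c, fun ε => ?_,
    gauge_one_eq_exp_mul n, abelian_one_eq_sub n c, fun τ r hr => ?_⟩
  · rw [curvature_charapDuff hm n c hx, hodge_omegaForm_smulRight hm hx]
  · have hd : DifferentiableAt ℝ f x :=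
      (hf.differentiableOn (by simp)).differentiableAt ((isOpen_chart m).mem_nhds hx)
    exact ⟨covDeriv_smul_q n c hd v, covDeriv_exp_smul_q n c hd v⟩
  · refine ⟨isGaugeTransformation_gauge m n ε, ⟨cartesianGauge ε, analyticOnNhd_cartesianGauge ε,
      fun x hr hΘ hε => gauge_eq_cartesianGauge n ε (by linarith) hΘ hε⟩,
      gauge_mul_q_mul_inv n ε, isSU2Connection_abelian hm n c ε,
      fun x _ => gaugeTransform_gauge_charapDuff n c ε x, fun x hx => ?_⟩
    rw [omega_eq hm hx, curvature_abelian hm n c ε hx]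
  · obtain ⟨h1, h2⟩ := charges_eq hm n (norm_q n) (fun x hx => curvature_charapDuff hm n c hx) τ hr
    exact ⟨h1, h2, fun ε => charges_eq hm n (fun _ => norm_qk)
      (fun x hx => curvature_abelian hm n c ε hx) τ hr⟩
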